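/- In the (deterministic) SLOCAL model with locality $T$, the nodes of an $n$-node graph $G$ carry adversarial unique identifiers from $\{1,\dots,n^c\}$, where $c\ge 1$ is a constant, and are processed one by one in an adversarial order. Each node has an unbounded local memory, initially empty. When a node $v$ is processed, it sees the subgraph of $G$ induced by the nodes at distance at most $T(n)$ from $v$, together with their identifiers and the current contents of their local memories; based on this information and on $n$, it fixes its own output and writes its own local memory. An algorithm finds a $3$-coloring in a family of graphs if, for every graph of the family, every assignment of identifiers and every processing order, its outputs form a proper $3$-coloring. A two-dimensional grid is the Cartesian product of a path with $a\ge1$ nodes and a path with $b\ge1$ nodes; it has $n=ab$ nodes. **Theorem.** Let $c\ge 1$ and let $T\colon\mathbb N\to\mathbb N$ satisfy $T(n)=o(n^{1/10})$. Then there is no SLOCAL algorithm with locality $T$ that finds a $3$-coloring in two-dimensional grids. Likewise, there is no SLOCAL algorithm with locality $T$ that finds a $3$-coloring in bipartite graphs. -/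

import Mathlib

open Filter Asymptotics

/-- What a node sees when it is processed in the SLOCAL model, the nodes being named by their
unique identifiers: its own identifier, the labelled subgraph induced by its radius-`T`
neighborhood, and the contents of the local memories there. -/
structure SLOCALView (M : Type*) where
  /-- the identifier of the node being processed -/
  center : ℕ
  /-- the identifiers of the nodes in the neighborhood -/
  nodes : Set ℕ
  /-- the subgraph induced by the neighborhood, transported to identifiers -/
  graph : SimpleGraph ℕ
  /-- `(i, m)` belongs to this set iff the node with identifier `i` is in the neighborhood and its
  memory holds `m`; a node of the neighborhood whose memory is still empty contributes no pair -/
  memory : Set (ℕ × M)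

/-- A deterministic SLOCAL algorithm with output labels `Γ` and local memories that are either
empty or hold an element of `M`. Both its locality and its local rule may depend on the number
`n` of nodes. The rule turns a view into the final output label of the node and
the content to be stored in its memory. No computability is required. -/
structure SLOCALAlgorithm (M Γ : Type*) where
  locality : ℕ → ℕ
  step : ℕ → SLOCALView M → Γ × M

namespace SLOCALAlgorithm

/-- The set `B(v, T)` of nodes at distance at most `T` from `v`. -/
def nbhd {V : Type*} (G : SimpleGraph V) (v : V) (T : ℕ) : Set V :=
  {u | G.edist v u ≤ T}

/-- The radius-`T` view of `v` in the graph `G` with identifiers `ident`, where `S u` is the current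
state of node `u`: `none` if `u` has not been processed yet (so its memory is empty), and otherwise
its output label together with the content of its memory. -/
def view {V M Γ : Type*} (G : SimpleGraph V) (ident : V ↪ ℕ) (S : V → Option (Γ × M))
    (T : ℕ) (v : V) : SLOCALView M where
  center := ident v
  nodes := ident '' nbhd G v T
  graph := (G.induce (nbhd G v T)).map (fun u => ident u.1)
  memory := {p | ∃ u ∈ nbhd G v T, ∃ γ : Γ, S u = some (γ, p.2) ∧ ident u = p.1}

open Classical in
/-- Process node `v`: it sees its view, fixes its output, and writes its own memory. -/
noncomputable def process {M Γ V : Type*} [Fintype V] (A : SLOCALAlgorithm M Γ)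
    (G : SimpleGraph V) (ident : V ↪ ℕ) (S : V → Option (Γ × M)) (v : V) :
    V → Option (Γ × M) :=
  Function.update S v
    (some (A.step (Fintype.card V) (view G ident S (A.locality (Fintype.card V)) v)))

/-- Process the nodes one after another in the order `σ`, starting with empty memories. -/
noncomputable def run {M Γ V : Type*} [Fintype V] (A : SLOCALAlgorithm M Γ)
    (G : SimpleGraph V) (ident : V ↪ ℕ) (σ : List V) : V → Option (Γ × M) :=
  σ.foldl (A.process G ident) (fun _ => none)

/-- `A` finds a proper `k`-coloring in every (finite, simple) graph of the family `F`, for every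
assignment of unique identifiers from `{1, …, n ^ c}` and every order `σ` in which each
node is processed exactly once. -/
def FindsColoring {M : Type*} {k : ℕ} (A : SLOCALAlgorithm M (Fin k)) (c : ℕ)
    (F : ∀ {V : Type}, SimpleGraph V → Prop) : Prop :=
  ∀ (V : Type) [Fintype V] (G : SimpleGraph V), F G →
    ∀ ident : V ↪ ℕ, (∀ v, 1 ≤ ident v ∧ ident v ≤ Fintype.card V ^ c) →
      ∀ σ : List V, σ.Nodup → (∀ v, v ∈ σ) →
        ∃ C : G.Coloring (Fin k), ∀ v, (A.run G ident σ v).map Prod.fst = some (C v)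

end SLOCALAlgorithm

/-- A two-dimensional grid: the Cartesian product of a path with `a` nodes and a path with
`b` nodes. -/
def IsGridGraph {V : Type*} (G : SimpleGraph V) : Prop :=
  ∃ a b : ℕ, 0 < a ∧ 0 < b ∧
    Nonempty (G ≃g (SimpleGraph.pathGraph a □ SimpleGraph.pathGraph b))

/-! Lifting color changes modulo 3 to `±1` gives a 3-coloring of a grid a height function, since the
changes around a 4-cycle cancel. Hence the height difference between two fixed columns varies by at
most `2 * d` between rows at distance `d`.

Two rows at distance `2 * T + 1` are played against each other. Permuting the columns of identifiers
only from a row in between onwards leaves the colors of row `y₁` unchanged (`run_eq_of_fixed_row`).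
In row `y₀`, blocks of markers, processed first, shield a segment: its colors depend only on the
columns nearby, up to translation and reflection (`run_eq_of_segment`). So row `y₀` can be assembled
from cells whose height differences change sign under reversal.

Deleting the middle column of a cell changes the parity of its length, hence its height difference.
Take two arrangements, one short where the other is long; reversing suitable cells in both makes
each cell contribute at least 1 more in the first, while the joints contribute equally. After `8 * T
+ 6` cells the gap exceeds the `2 * (4 * T + 2)` that the common row `y₁` allows
(`IsLocalFamily.contradiction`). A side of order `T ^ 2` suffices. Grids are bipartite, which gives
the second claim. -/

namespace SLOCALAlgorithm

/-! ### Comparing runs through identifiers -/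

/-- The part of the view of `v` that does not change over time: the identifiers in the neighborhood
of `v` and the subgraph that the neighborhood induces, transported to identifiers. -/
def staticView {V : Type*} (G : SimpleGraph V) (ident : V → ℕ) (T : ℕ) (v : V) :
    Set ℕ × SimpleGraph ℕ :=
  (ident '' nbhd G v T, (G.induce (nbhd G v T)).map (fun u => ident u.1))

/-- A run of the local rule `step` in which nodes are replaced by their identifiers. -/
def idRun {M Γ : Type*} (step : SLOCALView M → Γ × M) (env : ℕ → Set ℕ × SimpleGraph ℕ)
    (ν : List ℕ) : ℕ → Option (Γ × M) :=
  ν.foldl (fun s k => Function.update s k (some (step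
    { center := k
      nodes := (env k).1
      graph := (env k).2
      memory := {p | p.1 ∈ (env k).1 ∧ ∃ γ : Γ, s p.1 = some (γ, p.2)} }))) (fun _ => none)

/-- A step sees nodes only through their identifiers. This makes runs under different identifier
assignments comparable. -/
theorem run_eq_idRun {M Γ V : Type*} [Fintype V] (A : SLOCALAlgorithm M Γ) (G : SimpleGraph V)
    (ident : V ↪ ℕ) (env : ℕ → Set ℕ × SimpleGraph ℕ)
    (henv : ∀ v, env (ident v) = staticView G ident (A.locality (Fintype.card V)) v)
    (σ : List V) (v : V) :
    A.run G ident σ v = idRun (A.step (Fintype.card V)) env (σ.map ident) (ident v) := by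
  classical
  induction σ using List.reverseRecOn generalizing v with
  | nil => rfl
  | append_singleton σ w ih =>
    have h1 : A.run G ident (σ ++ [w]) = A.process G ident (A.run G ident σ) w := by
      simp [run, List.foldl_append]
    rw [h1]
    simp only [idRun, List.map_append, List.map_cons, List.map_nil, List.foldl_append,
      List.foldl_cons, List.foldl_nil]
    change _ = Function.update (idRun _ env (σ.map ident)) _ _ _
    unfold process
    by_cases hvw : v = w
    · subst hvw
      rw [Function.update_self, Function.update_self]
      congr 2
      rw [view, henv]
      congr 1
      ext ⟨i, m⟩
      simp only [Set.mem_ofPred_eq, staticView]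
      constructor
      · rintro ⟨u, hu, γ, hS, rfl⟩
        exact ⟨⟨u, hu, rfl⟩, γ, by rw [← hS, ih u]; rfl⟩
      · rintro ⟨⟨u, hu, rfl⟩, γ, hS⟩
        exact ⟨u, hu, γ, by rw [ih u, ← hS]; rfl, rfl⟩
    · rw [Function.update_of_ne hvw, Function.update_of_ne (fun h => hvw (ident.injective h)), ih]

/-- Two runs agree on a set `D` of identifiers if their static views agree on `D` and no node of `D`
sees an already processed node outside `D`. -/
theorem idRun_congr {M Γ : Type*} (step : SLOCALView M → Γ × M)
    (env env' : ℕ → Set ℕ × SimpleGraph ℕ) (rank : ℕ → ℕ) (D : Set ℕ)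
    (henv : ∀ k ∈ D, env k = env' k)
    (hclosed : ∀ k ∈ D, ∀ u ∈ (env k).1, rank u ≤ rank k → u ∈ D)
    (ν : List ℕ) (hν : ν.Pairwise (fun a b => rank a ≤ rank b)) :
    ∀ k ∈ D, idRun step env ν k = idRun step env' ν k := by
  induction ν using List.reverseRecOn with
  | nil => intro k _; rfl
  | append_singleton ν w ih =>
    intro k hk
    rw [List.pairwise_append] at hν
    obtain ⟨hν1, -, hν2⟩ := hν
    have unprocessed : ∀ (e : ℕ → Set ℕ × SimpleGraph ℕ) (μ : List ℕ) (u : ℕ), u ∉ μ →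
        idRun step e μ u = none := by
      intro e μ u
      induction μ using List.reverseRecOn with
      | nil => intro _; rfl
      | append_singleton μ x ihμ =>
        intro hu
        simp only [List.mem_append, List.mem_singleton, not_or] at hu
        simp only [idRun, List.foldl_append, List.foldl_cons, List.foldl_nil]
        rw [Function.update_of_ne hu.2]
        exact ihμ hu.1
    simp only [idRun, List.foldl_append, List.foldl_cons, List.foldl_nil]
    change Function.update (idRun step env ν) _ _ _ = Function.update (idRun step env' ν) _ _ _
    by_cases hkw : k = w
    · subst hkw
      rw [Function.update_self, Function.update_self]
      change some (step ⟨k, _, _, {p | _ ∧ ∃ γ, idRun step env ν p.1 = _}⟩) =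
        some (step ⟨k, _, _, {p | _ ∧ ∃ γ, idRun step env' ν p.1 = _}⟩)
      rw [← henv k hk]
      congr 3
      ext ⟨i, m⟩
      simp only [Set.mem_ofPred_eq]
      refine and_congr_right fun hi => ?_
      -- A visible node outside `D` has not been processed, so its memory is empty in both runs.
      have : idRun step env ν i = idRun step env' ν i := by
        by_cases hiν : i ∈ ν
        · exact ih hν1 i (hclosed k hk i hi (hν2 i hiν k (by simp)))
        · rw [unprocessed _ _ _ hiν, unprocessed _ _ _ hiν]
      rw [this]
    · rw [Function.update_of_ne hkw, Function.update_of_ne hkw]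
      exact ih hν1 k hk

/-- `D` couples nodes that play the same role in the two runs. Closure is needed only for neighbors
of no larger rank, as the others come later. -/
theorem run_congr {M Γ V : Type*} [Fintype V] (A : SLOCALAlgorithm M Γ) (G : SimpleGraph V)
    (ident ident' : V ↪ ℕ) (σ σ' : List V) (hσ : σ.map ident = σ'.map ident')
    (rank : ℕ → ℕ) (hrank : (σ.map ident).Pairwise (fun a b => rank a ≤ rank b))
    (D : V → V → Prop) (hid : ∀ v v', D v v' → ident v = ident' v')
    (hview : ∀ v v', D v v' → staticView G ident (A.locality (Fintype.card V)) v =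
      staticView G ident' (A.locality (Fintype.card V)) v')
    (hclosed : ∀ v v', D v v' → ∀ u ∈ nbhd G v (A.locality (Fintype.card V)),
      rank (ident u) ≤ rank (ident v) → ∃ u', D u u') (v v' : V) (hv : D v v') :
    A.run G ident σ v = A.run G ident' σ' v' := by
  have : Nonempty V := ⟨v⟩
  have key : ∀ i : V ↪ ℕ, ∀ w, (fun k => staticView G i (A.locality (Fintype.card V))
      (Function.invFun i k)) (i w) = staticView G i (A.locality (Fintype.card V)) w := by
    intro i w
    simp only [Function.leftInverse_invFun i.injective w]
  rw [run_eq_idRun A G ident (fun k => staticView G ident (A.locality (Fintype.card V))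
      (Function.invFun ident k)) (key ident),
    run_eq_idRun A G ident' (fun k => staticView G ident' (A.locality (Fintype.card V))
      (Function.invFun ident' k)) (key ident'), ← hσ,
    ← hid v v' hv]
  refine idRun_congr _ _ _ rank {k | ∃ u u', D u u' ∧ ident u = k} ?_ ?_ _ hrank _
    ⟨v, v', hv, rfl⟩
  · rintro k ⟨u, u', hu, rfl⟩
    rw [Function.leftInverse_invFun ident.injective u, hid u u' hu,
      Function.leftInverse_invFun ident'.injective u', hview u u' hu]
  · rintro k ⟨u, u', hu, rfl⟩ j hj hjr
    rw [Function.leftInverse_invFun ident.injective u] at hj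
    obtain ⟨w, hw, rfl⟩ := hj
    obtain ⟨w', hw'⟩ := hclosed u u' hu w hw hjr
    exact ⟨w, w', hw', rfl⟩

/-- Static views agree if a relation between the two neighborhoods matches up identifiers and
adjacency. -/
theorem staticView_congr {V : Type*} (G : SimpleGraph V) (ident ident' : V → ℕ) (T : ℕ) (v v' : V)
    (R : V → V → Prop) (h1 : ∀ u ∈ nbhd G v T, ∃ u' ∈ nbhd G v' T, R u u')
    (h2 : ∀ u' ∈ nbhd G v' T, ∃ u ∈ nbhd G v T, R u u')
    (hid : ∀ u ∈ nbhd G v T, ∀ u', R u u' → ident u = ident' u')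
    (hadj : ∀ u w u' w', R u u' → R w w' → (G.Adj u w ↔ G.Adj u' w')) :
    staticView G ident T v = staticView G ident' T v' := by
  refine Prod.ext ?_ ?_
  · ext k
    constructor
    · rintro ⟨u, hu, rfl⟩
      obtain ⟨u', hu', hR⟩ := h1 u hu
      exact ⟨u', hu', (hid u hu u' hR).symm⟩
    · rintro ⟨u', hu', rfl⟩
      obtain ⟨u, hu, hR⟩ := h2 u' hu'
      exact ⟨u, hu, hid u hu u' hR⟩
  · ext i j
    simp only [staticView, SimpleGraph.map_adj', SimpleGraph.comap_adj, Subtype.exists,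
      Function.Embedding.subtype_apply]
    refine and_congr_right fun _ => ?_
    constructor
    · rintro ⟨u, hu, w, hw, ha, rfl, rfl⟩
      obtain ⟨u', hu', hR⟩ := h1 u hu
      obtain ⟨w', hw', hR'⟩ := h1 w hw
      exact ⟨u', hu', w', hw', (hadj u w u' w' hR hR').1 ha, (hid u hu u' hR).symm,
        (hid w hw w' hR').symm⟩
    · rintro ⟨u', hu', w', hw', ha, rfl, rfl⟩
      obtain ⟨u, hu, hR⟩ := h2 u' hu'
      obtain ⟨w, hw, hR'⟩ := h2 w' hw'
      exact ⟨u, hu, w, hw, (hadj u w u' w' hR hR').2 ha, hid u hu u' hR, hid w hw w' hR'⟩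

end SLOCALAlgorithm

/-! ### Distances, identifiers and processing orders in the square grid -/

theorem pathGraph_edist {n : ℕ} (i j : Fin n) :
    (SimpleGraph.pathGraph n).edist i j = (((i : ℤ) - j).natAbs : ℕ) := by
  apply le_antisymm
  · have up : ∀ (d : ℕ) (i j : Fin n), (j : ℕ) = i + d → (SimpleGraph.pathGraph n).edist i j ≤ d := by
      intro d
      induction d with
      | zero =>
        intro i j h
        have : i = j := Fin.ext (by omega)
        simp [this]
      | succ d ih =>
        intro i j h
        have h1 := ih i ⟨i + d, by omega⟩ rfl
        have h2 : (SimpleGraph.pathGraph n).edist ⟨i + d, by omega⟩ j = 1 := by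
          rw [SimpleGraph.edist_eq_one_iff_adj, SimpleGraph.pathGraph_adj]
          simp only
          omega
        calc _ ≤ _ := SimpleGraph.edist_triangle
          _ ≤ (d : ℕ∞) + 1 := add_le_add h1 h2.le
          _ = _ := by push_cast; rfl
    rcases le_total (i : ℕ) j with h | h
    · exact up _ i j (by omega)
    · rw [SimpleGraph.edist_comm]
      exact up _ j i (by omega)
  · have : ∀ (i j : Fin n) (w : (SimpleGraph.pathGraph n).Walk i j),
        ((i : ℤ) - j).natAbs ≤ w.length := by
      intro i j w
      induction w with
      | nil => simp
      | cons h w ih =>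
        rw [SimpleGraph.pathGraph_adj] at h
        rw [SimpleGraph.Walk.length_cons]
        omega
    rw [SimpleGraph.edist_eq_sInf]
    refine le_sInf ?_
    rintro _ ⟨w, rfl⟩
    exact Nat.cast_le.2 (this i j w)

namespace SLOCALAlgorithm

/-- The square grid. -/
abbrev squareGrid (N : ℕ) : SimpleGraph (Fin N × Fin N) :=
  SimpleGraph.pathGraph N □ SimpleGraph.pathGraph N

theorem mem_nbhd_squareGrid {N T : ℕ} (u v : Fin N × Fin N) :
    u ∈ nbhd (squareGrid N) v T ↔
      |(u.1 : ℤ) - v.1| + |(u.2 : ℤ) - v.2| ≤ T := by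
  rw [nbhd, Set.mem_ofPred_eq, SimpleGraph.edist_boxProd, pathGraph_edist, pathGraph_edist]
  rw [← Nat.cast_add, Nat.cast_le, Int.abs_eq_natAbs, Int.abs_eq_natAbs]
  omega

/-- Identifiers of the square grid, in which the columns are permuted by `π` from row `H` on. -/
def gridIdent (N H : ℕ) (π : Equiv.Perm (Fin N)) : Fin N × Fin N ↪ ℕ where
  toFun v := 1 + (N * v.2 + (if H ≤ (v.2 : ℕ) then π v.1 else v.1 : Fin N))
  inj' := by
    intro v w h
    have dm : ∀ (y : ℕ) (x : Fin N), (N * y + x) / N = y := fun y x => by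
      rw [Nat.mul_add_div x.pos, Nat.div_eq_of_lt x.2, add_zero]
    have h' := Nat.add_left_cancel h
    have h2 : v.2 = w.2 := by
      have := congrArg (· / N) h'
      simp only [dm] at this
      exact Fin.ext this
    rw [h2] at h'
    have h3 := Fin.ext (Nat.add_left_cancel h')
    refine Prod.ext ?_ h2
    split_ifs at h3
    · exact π.injective h3
    · exact h3

theorem gridIdent_apply (N H : ℕ) (π : Equiv.Perm (Fin N)) (v : Fin N × Fin N) :
    gridIdent N H π v = 1 + (N * v.2 + (if H ≤ (v.2 : ℕ) then π v.1 else v.1 : Fin N)) := rfl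

theorem gridIdent_mem (N H : ℕ) (π : Equiv.Perm (Fin N)) (v : Fin N × Fin N) :
    1 ≤ gridIdent N H π v ∧ gridIdent N H π v ≤ N * N := by
  rw [gridIdent_apply]
  refine ⟨by omega, ?_⟩
  have h1 : N * (v.2 : ℕ) + N ≤ N * N := by
    rw [← Nat.mul_succ]; exact Nat.mul_le_mul_left _ v.2.2
  have h2 := (if H ≤ (v.2 : ℕ) then π v.1 else v.1 : Fin N).2
  omega

open Classical in
/-- The phase in which an identifier is processed: first the markers `mk` of row `y₀`, then the rest
of the rows `y₀` and `y₁`, then all other nodes. -/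
noncomputable def gridRank (N y₀ y₁ : ℕ) (mk : ℕ → Prop) (k : ℕ) : ℕ :=
  if (k - 1) / N = y₀ then (if mk ((k - 1) % N) then 0 else 1)
  else if (k - 1) / N = y₁ then 1 else 2

open Classical in
theorem gridRank_gridIdent (N H y₀ y₁ : ℕ) (mk : ℕ → Prop) (π : Equiv.Perm (Fin N))
    (v : Fin N × Fin N) (hH : H ≤ y₀) : gridRank N y₀ y₁ mk (gridIdent N H π v) =
      if (v.2 : ℕ) = y₀ then (if mk (π v.1) then 0 else 1)
      else if (v.2 : ℕ) = y₁ then 1 else 2 := by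
  have h1 : (gridIdent N H π v - 1) / N = v.2 := by
    rw [gridIdent_apply, Nat.add_sub_cancel_left, Nat.mul_add_div v.1.pos,
      Nat.div_eq_of_lt (Fin.is_lt _), add_zero]
  unfold gridRank
  rw [h1]
  by_cases hv : (v.2 : ℕ) = y₀
  · have h2 : (gridIdent N H π v - 1) % N = π v.1 := by
      rw [gridIdent_apply, Nat.add_sub_cancel_left, Nat.mul_add_mod, Nat.mod_eq_of_lt (Fin.is_lt _),
        if_pos (by omega)]
    rw [h2]
  · simp [hv]

theorem exists_list_rank_le (S : Finset ℕ) (rank : ℕ → ℕ) : ∃ ν : List ℕ,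
    ν.Nodup ∧ (∀ k, k ∈ ν ↔ k ∈ S) ∧ ν.Pairwise (fun a b => rank a ≤ rank b) := by
  induction S using Finset.induction_on_max_value rank with
  | empty => exact ⟨[], by simp⟩
  | insert a s ha hmax ih =>
    obtain ⟨ν, h1, h2, h3⟩ := ih
    refine ⟨ν ++ [a], ?_, ?_, ?_⟩
    · rw [List.nodup_append]
      refine ⟨h1, by simp, ?_⟩
      rintro k hk j hj rfl
      rw [List.mem_singleton] at hj
      exact ha (hj ▸ (h2 k).1 hk)
    · intro k
      simp [h2, or_comm]
    · rw [List.pairwise_append]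
      refine ⟨h3, by simp, ?_⟩
      intro k hk j hj
      rw [List.mem_singleton] at hj
      exact hj ▸ hmax k ((h2 k).1 hk)

/-- The identifiers exhaust `{1, …, n}`, so one order of identifiers can serve all column
permutations. -/
theorem exists_order {V : Type*} [Fintype V] (ident : V ↪ ℕ)
    (hident : ∀ v, 1 ≤ ident v ∧ ident v ≤ Fintype.card V) (ν : List ℕ) (hν : ν.Nodup)
    (hmem : ∀ k, k ∈ ν ↔ k ∈ Finset.Icc 1 (Fintype.card V)) :
    ∃ σ : List V, σ.map ident = ν ∧ σ.Nodup ∧ ∀ v, v ∈ σ := by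
  classical
  have him : Finset.univ.image ident = Finset.Icc 1 (Fintype.card V) := by
    apply Finset.eq_of_subset_of_card_le
    · intro k hk
      obtain ⟨v, -, rfl⟩ := Finset.mem_image.1 hk
      exact Finset.mem_Icc.2 (hident v)
    · rw [Finset.card_image_of_injective _ ident.injective]
      simp
  have hr : ∀ k ∈ ν, ∃ v, ident v = k := by
    intro k hk
    have := (hmem k).1 hk
    rw [← him] at this
    simpa using this
  obtain ⟨σ, hσ⟩ : ∃ σ : List V, σ.map ident = ν := by
    have : ν ∈ Set.range (List.map ident) := by
      rw [Set.range_list_map]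
      exact fun k hk => hr k hk
    exact this
  refine ⟨σ, hσ, List.Nodup.of_map ident (hσ ▸ hν), fun v => ?_⟩
  have : ident v ∈ σ.map ident := by
    rw [hσ, hmem]
    exact Finset.mem_Icc.2 (hident v)
  obtain ⟨w, hw, hwv⟩ := List.mem_map.1 this
  exact ident.injective hwv ▸ hw

/-! ### Locality of the outputs in the two rows -/

/-- The outputs in row `y₁` do not depend on the permutation of the columns in the rows above. -/
theorem run_eq_of_fixed_row {M Γ : Type*} (A : SLOCALAlgorithm M Γ) (N H y₀ y₁ : ℕ) (mk : ℕ → Prop)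
    (π π' : Equiv.Perm (Fin N)) (σ σ' : List (Fin N × Fin N))
    (hσ : σ.map (gridIdent N H π) = σ'.map (gridIdent N H π'))
    (hrank : (σ.map (gridIdent N H π)).Pairwise
      (fun a b => gridRank N y₀ y₁ mk a ≤ gridRank N y₀ y₁ mk b))
    (T : ℕ) (hT : T = A.locality (Fintype.card (Fin N × Fin N)))
    (h1 : y₁ + T < H) (h0 : H ≤ y₀) (v : Fin N × Fin N) (hv : (v.2 : ℕ) = y₁) :
    A.run (squareGrid N) (gridIdent N H π) σ v =
      A.run (squareGrid N) (gridIdent N H π') σ' v := by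
  subst hT
  refine run_congr A _ _ _ σ σ' hσ (gridRank N y₀ y₁ mk) hrank
    (fun v v' => v = v' ∧ (v.2 : ℕ) = y₁) ?_ ?_ ?_ v v ⟨rfl, hv⟩
  · rintro v _ ⟨rfl, hv⟩
    rw [gridIdent_apply, gridIdent_apply, if_neg (by omega), if_neg (by omega)]
  · rintro v _ ⟨rfl, hv⟩
    refine staticView_congr _ _ _ _ _ _ Eq (fun u hu => ⟨u, hu, rfl⟩) (fun u hu => ⟨u, hu, rfl⟩)
      ?_ ?_
    · rintro u hu _ rfl
      rw [mem_nbhd_squareGrid] at hu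
      have := abs_nonneg ((u.1 : ℤ) - v.1)
      have := le_abs_self ((u.2 : ℤ) - v.2)
      rw [gridIdent_apply, gridIdent_apply, if_neg (by omega), if_neg (by omega)]
    · rintro u w _ _ rfl rfl
      rfl
  -- Row `y₀` is out of sight and the rows other than `y₀` and `y₁` come last, so only row `y₁`
  -- matters.
  · rintro v _ ⟨rfl, hv⟩ u hu hr
    rw [gridRank_gridIdent _ _ _ _ _ _ _ h0, gridRank_gridIdent _ _ _ _ _ _ _ h0] at hr
    rw [mem_nbhd_squareGrid] at hu
    have := abs_nonneg ((u.1 : ℤ) - v.1)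
    have := le_abs_self ((u.2 : ℤ) - v.2)
    refine ⟨u, rfl, ?_⟩
    by_contra hu'
    rw [if_neg (by omega), if_neg hu', if_neg (by omega), if_pos hv] at hr
    omega

/-- The columns of `π` around the segment `[p, p + l]` are those of `π'` around a segment with
endpoint `p'` that is passed in the direction `ε`, and the segment starts and ends with exactly the
markers of a whole block. -/
structure SegmentMatch (N T : ℕ) (mk : ℕ → Prop) (π π' : Equiv.Perm (Fin N)) (ε p p' l : ℤ) :
    Prop where
  sign : ε = 1 ∨ ε = -1
  left : T ≤ p
  right : p + l + T < N
  start_nonneg : 0 ≤ p' - ε * T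
  start_lt : p' - ε * T < N
  end_nonneg : 0 ≤ p' + ε * (l + T)
  end_lt : p' + ε * (l + T) < N
  eq : ∀ u u' : Fin N, p - T ≤ u → u ≤ p + l + T → u' - p' = ε * (u - p) → π u = π' u'
  mk_left : ∀ u : Fin N, p ≤ u → (u : ℤ) < p + T → mk (π u)
  mk_right : ∀ u : Fin N, p + l - T < u → u ≤ p + l → mk (π u)
  not_mk_left : ∀ u : Fin N, p - T ≤ u → (u : ℤ) < p → ¬ mk (π u)
  not_mk_right : ∀ u : Fin N, p + l < u → u ≤ p + l + T → ¬ mk (π u)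

/-- The outputs along a segment of row `y₀` that starts and ends with markers depend only on the
columns close to the segment, and on them only up to translation and reflection. -/
theorem run_eq_of_segment {M Γ : Type*} (A : SLOCALAlgorithm M Γ) (N H y₀ y₁ : ℕ) (mk : ℕ → Prop)
    (π π' : Equiv.Perm (Fin N)) (σ σ' : List (Fin N × Fin N))
    (hσ : σ.map (gridIdent N H π) = σ'.map (gridIdent N H π'))
    (hrank : (σ.map (gridIdent N H π)).Pairwise
      (fun a b => gridRank N y₀ y₁ mk a ≤ gridRank N y₀ y₁ mk b))
    (T : ℕ) (hT : T = A.locality (Fintype.card (Fin N × Fin N)))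
    (h1 : y₁ + T < H) (h0 : H + T ≤ y₀) (ε p p' l : ℤ)
    (hseg : SegmentMatch N T mk π π' ε p p' l)
    (v v' : Fin N × Fin N) (hv : (v.2 : ℕ) = y₀) (hv' : (v'.2 : ℕ) = y₀) (hvp : p ≤ v.1)
    (hvl : v.1 ≤ p + l) (hvv : v'.1 - p' = ε * (v.1 - p)) :
    A.run (squareGrid N) (gridIdent N H π) σ v =
      A.run (squareGrid N) (gridIdent N H π') σ' v' := by
  obtain ⟨hε, hp, hpl, hp1, hp2, hp3, hp4, hπ, hm1, hm2, hm3, hm4⟩ := hseg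
  subst hT
  set T := A.locality (Fintype.card (Fin N × Fin N)) with hT
  have hex : ∀ u : Fin N, p - T ≤ u → u ≤ p + l + T →
      ∃ u' : Fin N, (u' : ℤ) - p' = ε * (u - p) := by
    intro u hu hu'
    rcases hε with rfl | rfl
    · exact ⟨⟨(p' + (u - p)).toNat, by omega⟩, by simp only; omega⟩
    · exact ⟨⟨(p' - (u - p)).toNat, by omega⟩, by simp only; omega⟩
  refine run_congr A _ _ _ σ σ' hσ (gridRank N y₀ y₁ mk) hrank
    (fun v v' => (v.2 : ℕ) = y₀ ∧ (v'.2 : ℕ) = y₀ ∧ p ≤ v.1 ∧ v.1 ≤ p + l ∧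
      (v'.1 : ℤ) - p' = ε * (v.1 - p)) ?_ ?_ ?_ v v' ⟨hv, hv', hvp, hvl, hvv⟩
  · rintro v v' ⟨hv, hv', hvp, hvl, hvv⟩
    rw [gridIdent_apply, gridIdent_apply, if_pos (by omega), if_pos (by omega), hv, hv',
      hπ v.1 v'.1 (by omega) (by omega) hvv]
  · rintro v v' ⟨hv, hv', hvp, hvl, hvv⟩
    refine staticView_congr _ _ _ _ _ _
      (fun u u' => u.2 = u'.2 ∧ (u'.1 : ℤ) - p' = ε * (u.1 - p)) ?_ ?_ ?_ ?_
    · intro u hu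
      rw [mem_nbhd_squareGrid] at hu
      have := abs_nonneg ((u.2 : ℤ) - v.2)
      have := neg_abs_le ((u.1 : ℤ) - v.1)
      have := le_abs_self ((u.1 : ℤ) - v.1)
      obtain ⟨u', hu'⟩ := hex u.1 (by omega) (by omega)
      refine ⟨(u', u.2), ?_, rfl, hu'⟩
      rw [mem_nbhd_squareGrid]
      rcases hε with rfl | rfl <;> simp only <;> rw [Int.abs_eq_natAbs, Int.abs_eq_natAbs] at * <;>
        omega
    · intro u' hu
      rw [mem_nbhd_squareGrid] at hu
      have := abs_nonneg ((u'.2 : ℤ) - v'.2)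
      have := neg_abs_le ((u'.1 : ℤ) - v'.1)
      have := le_abs_self ((u'.1 : ℤ) - v'.1)
      obtain ⟨u, hu1, hu2⟩ : ∃ u : Fin N, (u'.1 : ℤ) - p' = ε * (u - p) ∧
          |(u : ℤ) - v.1| = |(u'.1 : ℤ) - v'.1| := by
        rcases hε with rfl | rfl
        · refine ⟨⟨(p + (u'.1 - p')).toNat, by omega⟩, by simp only; omega, ?_⟩
          rw [Int.abs_eq_natAbs, Int.abs_eq_natAbs]
          simp only
          omega
        · refine ⟨⟨(p - (u'.1 - p')).toNat, by omega⟩, by simp only; omega, ?_⟩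
          rw [Int.abs_eq_natAbs, Int.abs_eq_natAbs]
          simp only
          omega
      refine ⟨(u, u'.2), ?_, rfl, hu1⟩
      rw [mem_nbhd_squareGrid]
      simp only
      rw [hu2, hv, ← hv']
      exact hu
    · rintro u hu u' ⟨hR, hR'⟩
      rw [mem_nbhd_squareGrid] at hu
      have := abs_nonneg ((u.1 : ℤ) - v.1)
      have := abs_nonneg ((u.2 : ℤ) - v.2)
      have := neg_abs_le ((u.1 : ℤ) - v.1)
      have := le_abs_self ((u.1 : ℤ) - v.1)
      have := neg_abs_le ((u.2 : ℤ) - v.2)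
      rw [gridIdent_apply, gridIdent_apply, ← hR, if_pos (by omega), if_pos (by omega),
        hπ u.1 u'.1 (by omega) (by omega) hR']
    · rintro u w u' w' ⟨h1, h2⟩ ⟨h3, h4⟩
      rw [SimpleGraph.boxProd_adj, SimpleGraph.boxProd_adj, SimpleGraph.pathGraph_adj,
        SimpleGraph.pathGraph_adj, SimpleGraph.pathGraph_adj, SimpleGraph.pathGraph_adj, h1, h3,
        Fin.ext_iff, Fin.ext_iff, Fin.ext_iff]
      rcases hε with rfl | rfl <;> omega
  · rintro v v' ⟨hv, hv', hvp, hvl, hvv⟩ u hu hr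
    rw [gridRank_gridIdent _ _ _ _ _ _ _ (by omega),
      gridRank_gridIdent _ _ _ _ _ _ _ (by omega)] at hr
    rw [mem_nbhd_squareGrid] at hu
    have := abs_nonneg ((u.1 : ℤ) - v.1)
    have := abs_nonneg ((u.2 : ℤ) - v.2)
    have := neg_abs_le ((u.1 : ℤ) - v.1)
    have := le_abs_self ((u.1 : ℤ) - v.1)
    have := neg_abs_le ((u.2 : ℤ) - v.2)
    rw [if_pos hv] at hr
    have hu0 : (u.2 : ℕ) = y₀ := by
      by_contra hu0
      rw [if_neg hu0, if_neg (by omega)] at hr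
      split_ifs at hr <;> omega
    rw [if_pos hu0] at hr
    have hum : mk (π v.1) → mk (π u.1) := by
      intro h
      by_contra h'
      rw [if_pos h, if_neg h'] at hr
      omega
    obtain ⟨u', hu'⟩ := hex u.1 (by omega) (by omega)
    -- A node `u` beyond the end would put `v` in the end block of markers; then `u`, processed no
    -- later, would be a marker too.
    have hpu : p ≤ u.1 := by
      by_contra h
      exact hm3 u.1 (by omega) (by omega) (hum (hm1 v.1 hvp (by omega)))
    have hul : (u.1 : ℤ) ≤ p + l := by
      by_contra h
      exact hm4 u.1 (by omega) (by omega) (hum (hm2 v.1 (by omega) hvl))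
    exact ⟨(u', u.2), hu0, hu0, hpu, hul, hu'⟩

end SLOCALAlgorithm

/-! ### Height functions of 3-colorings -/

/-- The lift to `{-1, 1}` of the difference modulo `3` of two distinct colors. -/
def colorStep (a b : Fin 3) : ℤ := if b = a then 0 else if b = a + 1 then 1 else -1

theorem colorStep_symm : ∀ a b : Fin 3, colorStep b a = -colorStep a b := by decide

theorem colorStep_odd : ∀ a b : Fin 3, a ≠ b → colorStep a b = 1 ∨ colorStep a b = -1 := by decide

theorem abs_colorStep_le : ∀ a b : Fin 3, |colorStep a b| ≤ 1 := by decide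

/-- Around the 4-cycle, four signs add up to an even multiple of 3 of absolute value at most 4, that
is, to 0. -/
theorem colorStep_square : ∀ a b c d : Fin 3, a ≠ b → b ≠ d → a ≠ c → c ≠ d →
    colorStep a b + colorStep b d = colorStep a c + colorStep c d := by decide

/-- `h` is a height function of the coloring `f` of the `N × N` grid. -/
structure IsHeight (N : ℕ) (f : ℕ → ℕ → Fin 3) (h : ℕ → ℕ → ℤ) : Prop where
  ne : ∀ x y, x + 1 < N → y < N → f x y ≠ f (x + 1) y
  hor : ∀ x y, x + 1 < N → y < N → h (x + 1) y - h x y = colorStep (f x y) (f (x + 1) y)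
  ver : ∀ x y, x < N → y + 1 < N → h x (y + 1) - h x y = colorStep (f x y) (f x (y + 1))

theorem exists_isHeight (N : ℕ) (f : ℕ → ℕ → Fin 3)
    (hf : ∀ x y, x + 1 < N → y < N → f x y ≠ f (x + 1) y)
    (hf' : ∀ x y, x < N → y + 1 < N → f x y ≠ f x (y + 1)) : ∃ h, IsHeight N f h := by
  -- Sum along row 0 and then along the column; the square relation carries horizontal steps from
  -- row to row.
  refine ⟨fun x y => (∑ i ∈ Finset.range x, colorStep (f i 0) (f (i + 1) 0)) +
    ∑ j ∈ Finset.range y, colorStep (f x j) (f x (j + 1)), hf, ?_, ?_⟩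
  · intro x y hx hy
    induction y with
    | zero => simp [Finset.sum_range_succ]
    | succ y ih =>
      have := ih (by omega)
      have sq := colorStep_square (f x y) (f (x + 1) y) (f x (y + 1)) (f (x + 1) (y + 1))
        (hf _ _ hx (by omega)) (hf' _ _ hx hy) (hf' _ _ (by omega) hy) (hf _ _ hx hy)
      simp only [Finset.sum_range_succ] at this ⊢
      linarith
  · intro x y _ _
    simp [Finset.sum_range_succ]

theorem IsHeight.even_sub {N f h} (H : IsHeight N f h) (y : ℕ) (hy : y < N) (x l : ℕ)
    (hx : x + l < N) : Even (h (x + l) y - h x y - l) := by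
  induction l with
  | zero => simp
  | succ l ih =>
    have h1 := ih (by omega)
    have h2 := H.hor (x + l) y (by omega) hy
    have h3 := colorStep_odd _ _ (H.ne (x + l) y (by omega) hy)
    rw [← add_assoc, Int.even_iff] at *
    push_cast
    omega

/-- The height differences along two rows between the same two columns are close. -/
theorem IsHeight.abs_sub_le {N f h} (H : IsHeight N f h) (x x' : ℕ) (hx : x < N) (hx' : x' < N)
    (y d : ℕ) (hd : y + d < N) :
    |(h x (y + d) - h x' (y + d)) - (h x y - h x' y)| ≤ 2 * d := by
  induction d with
  | zero => simp
  | succ d ih =>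
    have h1 := ih (by omega)
    have h2 := H.ver x (y + d) hx (by omega)
    have h3 := H.ver x' (y + d) hx' (by omega)
    have h4 := abs_colorStep_le (f x (y + d)) (f x (y + d + 1))
    have h5 := abs_colorStep_le (f x' (y + d)) (f x' (y + d + 1))
    rw [← h2] at h4
    rw [← h3] at h5
    rw [← add_assoc]
    push_cast
    rw [abs_le] at *
    constructor <;> linarith [h1.1, h1.2, h4.1, h4.2, h5.1, h5.2]

/-- Equal colors along two segments, possibly of opposite directions, give equal height
differences. -/
theorem IsHeight.sub_eq_sub {N f h f' h'} (H : IsHeight N f h) (H' : IsHeight N f' h') (y : ℕ)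
    (hy : y < N) (ε : ℤ) (hε : ε = 1 ∨ ε = -1) (p p' l : ℕ) (q q' : ℕ)
    (hq : q = p + l) (hq' : (q' : ℤ) = p' + ε * l) (hqN : q < N) (hpN' : p' < N) (hqN' : q' < N)
    (hc : ∀ u u' : ℕ, p ≤ u → u ≤ q → (u' : ℤ) - p' = ε * (u - p) → f u y = f' u' y) :
    h q y - h p y = h' q' y - h' p' y := by
  induction l generalizing q q' with
  | zero =>
    have : q' = p' := by simpa using hq'
    simp [hq, this]
  | succ l ih =>
    subst hq
    push_cast at hq'
    have h1 := H.hor (p + l) y (by omega) hy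
    have c2 := hc (p + l + 1) q' (by omega) (by omega) (by rw [hq']; push_cast; ring)
    rcases hε with rfl | rfl
    · obtain ⟨r, rfl⟩ : ∃ r, q' = r + 1 := ⟨q' - 1, by omega⟩
      have h2 := ih (p + l) r rfl (by push_cast at *; linarith) (by omega) (by omega)
        (fun u u' a b c => hc u u' a (by omega) c)
      have c1 := hc (p + l) r (by omega) (by omega) (by push_cast at *; linarith)
      have h3 := H'.hor r y hqN' hy
      rw [c1, c2] at h1
      rw [← add_assoc]
      linarith
    · have h2 := ih (p + l) (q' + 1) rfl (by push_cast at *; linarith) (by omega) (by omega)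
        (fun u u' a b c => hc u u' a (by omega) c)
      have c1 := hc (p + l) (q' + 1) (by omega) (by omega) (by push_cast at *; linarith)
      have h3 := H'.hor q' y (by omega) hy
      rw [c1, c2, colorStep_symm] at h1
      rw [← add_assoc]
      linarith

/-! ### Cells of columns and their markers -/

namespace SLOCALAlgorithm

/-- The number of columns of a cell; the middle column is missing if the cell is short. -/
def cellLen (K : ℕ) (s : Bool) : ℕ := if s then 6 * K else 6 * K + 1

/-- The position of the first column of the `i`-th cell. -/
def cellStart (K : ℕ) (s : ℕ → Bool) (i : ℕ) : ℕ := ∑ j ∈ Finset.range i, cellLen K (s j)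

/-- The name of the `t`-th column of a cell, which is reversed if `r` and short if `s`. -/
def cellCol (K : ℕ) (r s : Bool) (t : ℕ) : ℕ :=
  let j := if s ∧ 3 * K ≤ t then t + 1 else t
  if r then 6 * K - j else j

/-- `π` arranges columns into `Q` cells, which are reversed and short as told by `r` and `s`. -/
def IsArrangement (N Q K : ℕ) (r s : ℕ → Bool) (π : Equiv.Perm (Fin N)) : Prop :=
  ∀ i < Q, ∀ t < cellLen K (s i), ∀ x : Fin N, (x : ℕ) = cellStart K s i + t →
    (π x : ℕ) = i * (6 * K + 1) + cellCol K (r i) (s i) t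

theorem cellStart_succ (K : ℕ) (s : ℕ → Bool) (i : ℕ) :
    cellStart K s (i + 1) = cellStart K s i + cellLen K (s i) := Finset.sum_range_succ _ _

theorem cellStart_mono (K : ℕ) (s : ℕ → Bool) : Monotone (cellStart K s) :=
  monotone_nat_of_le_succ fun i => by rw [cellStart_succ]; omega

theorem cellLen_le (K : ℕ) (s : Bool) : cellLen K s ≤ 6 * K + 1 := by
  unfold cellLen; split_ifs <;> omega

theorem cellStart_le (K : ℕ) (s : ℕ → Bool) (i : ℕ) : cellStart K s i ≤ i * (6 * K + 1) := by
  induction i with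
  | zero => simp [cellStart]
  | succ i ih =>
    have := cellLen_le K (s i)
    rw [cellStart_succ, Nat.succ_mul]
    omega

theorem cellCol_le (K : ℕ) (r s : Bool) (t : ℕ) (ht : t < cellLen K s) :
    cellCol K r s t ≤ 6 * K := by
  unfold cellLen at ht
  unfold cellCol
  cases r <;> cases s <;> simp at * <;> (try split_ifs) <;> omega

theorem cellCol_inj (K : ℕ) (r s : Bool) (t t' : ℕ) (ht : t < cellLen K s) (ht' : t' < cellLen K s)
    (h : cellCol K r s t = cellCol K r s t') : t = t' := by
  unfold cellLen at ht ht'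
  unfold cellCol at h
  cases r <;> cases s <;> simp at * <;> (try split_ifs at h) <;> omega

theorem cellStart_add_inj (K : ℕ) (s : ℕ → Bool) (i i' t t' : ℕ) (ht : t < cellLen K (s i))
    (ht' : t' < cellLen K (s i')) (h : cellStart K s i + t = cellStart K s i' + t') :
    i = i' ∧ t = t' := by
  have hi : i = i' := by
    rcases lt_trichotomy i i' with hi | hi | hi
    · have := cellStart_mono K s (Nat.succ_le_of_lt hi)
      rw [Nat.succ_eq_add_one, cellStart_succ] at this
      omega
    · exact hi
    · have := cellStart_mono K s (Nat.succ_le_of_lt hi)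
      rw [Nat.succ_eq_add_one, cellStart_succ] at this
      omega
  subst hi
  exact ⟨rfl, by omega⟩

/-- The cells prescribe an injective partial map, and any extension to a permutation will do; names
missing from short cells land after the last cell. -/
theorem exists_isArrangement (N Q K : ℕ) (hN : Q * (6 * K + 1) ≤ N) (r s : ℕ → Bool) :
    ∃ π, IsArrangement N Q K r s π := by
  classical
  let S : Set (Fin N) := {x | ∃ i < Q, ∃ t < cellLen K (s i), (x : ℕ) = cellStart K s i + t}
  have hS : ∀ x : Fin N, ∃ k : Fin N, x ∈ S → ∃ i < Q, ∃ t < cellLen K (s i),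
      (x : ℕ) = cellStart K s i + t ∧ (k : ℕ) = i * (6 * K + 1) + cellCol K (r i) (s i) t := by
    intro x
    by_cases hx : x ∈ S
    · obtain ⟨i, hi, t, ht, hxt⟩ := hx
      have h1 := cellCol_le K (r i) (s i) t ht
      have h2 : (i + 1) * (6 * K + 1) ≤ Q * (6 * K + 1) := Nat.mul_le_mul_right _ hi
      rw [Nat.succ_mul] at h2
      exact ⟨⟨_, by omega⟩, fun _ => ⟨i, hi, t, ht, hxt, rfl⟩⟩
    · exact ⟨x, fun h => absurd h hx⟩
  choose f hf using hS
  have hinj : Set.InjOn f S := by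
    intro x hx x' hx' h
    obtain ⟨i, hi, t, ht, hxt, hk⟩ := hf x hx
    obtain ⟨i', hi', t', ht', hxt', hk'⟩ := hf x' hx'
    rw [h, hk'] at hk
    have dm : ∀ j c, c ≤ 6 * K → (j * (6 * K + 1) + c) / (6 * K + 1) = j := fun j c hc => by
      rw [mul_comm, Nat.mul_add_div (by omega), Nat.div_eq_of_lt (by omega), add_zero]
    have hii : i' = i := by
      have := congrArg (· / (6 * K + 1)) hk
      rwa [dm _ _ (cellCol_le _ _ _ _ ht'), dm _ _ (cellCol_le _ _ _ _ ht)] at this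
    subst hii
    have := cellCol_inj K _ _ t' t ht' ht (Nat.add_left_cancel hk)
    subst this
    exact Fin.ext (hxt.trans hxt'.symm)
  obtain ⟨g, hg⟩ := Set.MapsTo.exists_equiv_extend_of_card_eq (t := Finset.univ) (by simp)
    (s := S) (f := f) (by intro x _; simp) hinj
  refine ⟨g.trans (Equiv.subtypeUnivEquiv (by simp)), fun i hi t ht x hx => ?_⟩
  have hxS : x ∈ S := ⟨i, hi, t, ht, hx⟩
  obtain ⟨i', hi', t', ht', hxt', hk'⟩ := hf x hxS
  obtain ⟨rfl, rfl⟩ := cellStart_add_inj K s i i' t t' ht ht' (by omega)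
  rw [← hk', ← hg x hxS]
  rfl

/-- The deleted column `3 * K` is the fixed point of `j ↦ 6 * K - j`, so deletion commutes with
reversal. -/
theorem cellCol_reverse (K : ℕ) (r s : Bool) (t : ℕ) (ht : t < cellLen K s) :
    cellCol K (!r) s (cellLen K s - 1 - t) = cellCol K r s t := by
  unfold cellLen at *
  unfold cellCol
  cases r <;> cases s <;> simp at * <;> (try split_ifs) <;> omega

/-- The names of the marker columns. -/
def IsMarker (K k : ℕ) : Prop :=
  (K ≤ k % (6 * K + 1) ∧ k % (6 * K + 1) < 2 * K) ∨
    (4 * K < k % (6 * K + 1) ∧ k % (6 * K + 1) ≤ 5 * K)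

theorem isMarker_cellCol (K i : ℕ) (r s : Bool) (t : ℕ) (ht : t < cellLen K s) :
    IsMarker K (i * (6 * K + 1) + cellCol K r s t) ↔
      (K ≤ t ∧ t < 2 * K) ∨ (cellLen K s ≤ t + 2 * K ∧ t + K < cellLen K s) := by
  unfold IsMarker
  rw [add_comm, Nat.add_mul_mod_self_right,
    Nat.mod_eq_of_lt (Nat.lt_succ_of_le (cellCol_le K r s t ht))]
  unfold cellLen at *
  unfold cellCol
  cases r <;> cases s <;> simp at * <;> (try split_ifs) <;> omega

/-! ### Families of colorings produced by an algorithm -/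

/-- Colorings of the square grid, one for each arrangement of the columns, that are local in
row `y₀` and do not depend on the arrangement in row `y₁`. -/
structure IsLocalFamily (N T y₀ y₁ : ℕ) (mk : ℕ → Prop)
    (f : Equiv.Perm (Fin N) → ℕ → ℕ → Fin 3) : Prop where
  fixed : ∀ π π' x, x < N → f π x y₁ = f π' x y₁
  segment : ∀ π π' ε p p' l, SegmentMatch N T mk π π' ε p p' l → ∀ u u' : ℕ, p ≤ u → u ≤ p + l →
    (u' : ℤ) - p' = ε * (u - p) → f π u y₀ = f π' u' y₀

theorem exists_isLocalFamily {M : Type*} (c : ℕ) (hc : 1 ≤ c) (A : SLOCALAlgorithm M (Fin 3))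
    (hA : A.FindsColoring c (fun G => IsGridGraph G)) (N T H y₀ y₁ : ℕ)
    (hT : T = A.locality (N * N)) (h1 : y₁ + T < H) (h0 : H + T ≤ y₀) (hN : y₀ < N)
    (mk : ℕ → Prop) : ∃ (f : Equiv.Perm (Fin N) → ℕ → ℕ → Fin 3)
      (h : Equiv.Perm (Fin N) → ℕ → ℕ → ℤ),
      IsLocalFamily N T y₀ y₁ mk f ∧ ∀ π, IsHeight N (f π) (h π) := by
  have hcard : Fintype.card (Fin N × Fin N) = N * N := by simp
  obtain ⟨ν, hν1, hν2, hν3⟩ := exists_list_rank_le (Finset.Icc 1 (Fintype.card (Fin N × Fin N)))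
    (gridRank N y₀ y₁ mk)
  have hσ := fun π => exists_order (gridIdent N H π)
    (fun v => by rw [hcard]; exact gridIdent_mem N H π v) ν hν1 hν2
  choose σ hσ1 hσ2 hσ3 using hσ
  have hC := fun π => hA (Fin N × Fin N) (squareGrid N)
    ⟨N, N, by omega, by omega, ⟨SimpleGraph.Iso.refl⟩⟩ (gridIdent N H π)
    (fun v => ⟨(gridIdent_mem N H π v).1, by
      rw [hcard]
      exact (gridIdent_mem N H π v).2.trans (Nat.le_self_pow (by omega) _)⟩)
    (σ π) (hσ2 π) (hσ3 π)
  choose C hC using hC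
  have hCrun : ∀ π π' v v', A.run (squareGrid N) (gridIdent N H π) (σ π) v =
      A.run (squareGrid N) (gridIdent N H π') (σ π') v' → C π v = C π' v' := by
    intro π π' v v' h
    have := hC π v
    rw [h, hC π' v'] at this
    exact (Option.some.inj this).symm
  let f : Equiv.Perm (Fin N) → ℕ → ℕ → Fin 3 := fun π x y =>
    if h : x < N ∧ y < N then C π (⟨x, h.1⟩, ⟨y, h.2⟩) else 0
  have hf : ∀ π x y (hx : x < N) (hy : y < N), f π x y = C π (⟨x, hx⟩, ⟨y, hy⟩) :=
    fun π x y hx hy => dif_pos ⟨hx, hy⟩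
  have hh : ∀ π, ∃ h, IsHeight N (f π) h := by
    intro π
    refine exists_isHeight N (f π) ?_ ?_
    · intro x y hx hy
      rw [hf π x y (by omega) hy, hf π (x + 1) y hx hy]
      refine (C π).valid ?_
      simp [SimpleGraph.boxProd_adj, SimpleGraph.pathGraph_adj]
    · intro x y hx hy
      rw [hf π x y hx (by omega), hf π x (y + 1) hx hy]
      refine (C π).valid ?_
      simp [SimpleGraph.boxProd_adj, SimpleGraph.pathGraph_adj]
  choose h hh using hh
  refine ⟨f, h, ⟨?_, ?_⟩, hh⟩
  · intro π π' x hx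
    rw [hf π x y₁ hx (by omega), hf π' x y₁ hx (by omega)]
    refine hCrun _ _ _ _ ?_
    exact run_eq_of_fixed_row A N H y₀ y₁ mk π π' _ _ (by rw [hσ1, hσ1]) (by rw [hσ1]; exact hν3) T
      (by rw [hcard, hT]) h1 (by omega) _ rfl
  · intro π π' ε p p' l hseg u u' hu hul huu
    have hε := hseg.sign
    have := hseg.left
    have := hseg.right
    have := hseg.start_nonneg
    have := hseg.start_lt
    have := hseg.end_nonneg
    have := hseg.end_lt
    have hu' : u' < N := by rcases hε with rfl | rfl <;> omega
    rw [hf π u y₀ (by omega) hN, hf π' u' y₀ hu' hN]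
    refine hCrun _ _ _ _ ?_
    exact run_eq_of_segment A N H y₀ y₁ mk π π' _ _ (by rw [hσ1, hσ1]) (by rw [hσ1]; exact hν3) T
      (by rw [hcard, hT]) h1 h0 ε p p' l hseg _ _ rfl rfl hu hul huu

/-! ### Matching segments inside cells and across joints -/

theorem cellStart_add_lt {N Q K : ℕ} (hN : Q * (6 * K + 1) ≤ N) (s : ℕ → Bool) (i : ℕ)
    (hi : i < Q) : cellStart K s i + cellLen K (s i) ≤ N := by
  have h1 := cellStart_mono K s (Nat.succ_le_of_lt hi)
  rw [Nat.succ_eq_add_one, cellStart_succ] at h1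
  have h2 := cellStart_le K s Q
  omega

theorem le_cellLen (K : ℕ) (s : Bool) : 6 * K ≤ cellLen K s := by
  unfold cellLen; split_ifs <;> omega

theorem IsArrangement.isMarker {N Q K : ℕ} {r s : ℕ → Bool} {π : Equiv.Perm (Fin N)}
    (hπ : IsArrangement N Q K r s π) (i : ℕ) (hi : i < Q) (u : Fin N) (t : ℕ)
    (ht : t < cellLen K (s i)) (hu : (u : ℕ) = cellStart K s i + t) :
    IsMarker K (π u) ↔
      (K ≤ t ∧ t < 2 * K) ∨ (cellLen K (s i) ≤ t + 2 * K ∧ t + K < cellLen K (s i)) := by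
  rw [hπ i hi t ht u hu, isMarker_cellCol _ _ _ _ _ ht]

/-- The segment runs from the left marker block through the right one. The margins of `T + 1`
unmarked columns hide the adjacent cells. -/
theorem IsArrangement.segmentMatch_cell {N Q T : ℕ} {r s r' s' : ℕ → Bool}
    {π π' : Equiv.Perm (Fin N)} (hN : Q * (6 * (T + 1) + 1) ≤ N)
    (hπ : IsArrangement N Q (T + 1) r s π) (hπ' : IsArrangement N Q (T + 1) r' s' π')
    (i : ℕ) (hi : i < Q) (hs : s' i = s i) (ε p' : ℤ)
    (hε : (ε = 1 ∧ r' i = r i ∧ p' = cellStart (T + 1) s' i + (T + 1)) ∨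
      (ε = -1 ∧ r' i = !r i ∧ p' = cellStart (T + 1) s' i + cellLen (T + 1) (s i) - (T + 2))) :
    SegmentMatch N T (IsMarker (T + 1)) π π' ε (cellStart (T + 1) s i + (T + 1)) p'
      (cellLen (T + 1) (s i) - 1 - 2 * (T + 1)) := by
  have b := cellStart_add_lt hN s i hi
  have b' := cellStart_add_lt hN s' i hi
  have l := le_cellLen (T + 1) (s i)
  rw [hs] at b'
  have mk := fun (u : Fin N) (h1 : cellStart (T + 1) s i ≤ u)
    (h2 : (u : ℕ) < cellStart (T + 1) s i + cellLen (T + 1) (s i)) =>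
    hπ.isMarker i hi u (u - cellStart (T + 1) s i) (by omega) (by omega)
  refine ⟨?_, ?_, ?_, ?_, ?_, ?_, ?_, ?_, ?_, ?_, ?_, ?_⟩
  · rcases hε with ⟨h, -⟩ | ⟨h, -⟩ <;> simp [h]
  · omega
  · omega
  · rcases hε with ⟨rfl, -, rfl⟩ | ⟨rfl, -, rfl⟩ <;> omega
  · rcases hε with ⟨rfl, -, rfl⟩ | ⟨rfl, -, rfl⟩ <;> omega
  · rcases hε with ⟨rfl, -, rfl⟩ | ⟨rfl, -, rfl⟩ <;> omega
  · rcases hε with ⟨rfl, -, rfl⟩ | ⟨rfl, -, rfl⟩ <;> omega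
  · intro u u' hu1 hu2 huu
    obtain ⟨t, ht⟩ : ∃ t, (u : ℕ) = cellStart (T + 1) s i + t :=
      ⟨u - cellStart (T + 1) s i, by omega⟩
    have htl : t < cellLen (T + 1) (s i) := by omega
    rw [Fin.ext_iff, hπ i hi t htl u ht]
    rcases hε with ⟨rfl, hr, rfl⟩ | ⟨rfl, hr, rfl⟩
    · rw [hπ' i hi t (by rw [hs]; exact htl) u' (by omega), hs, hr]
    · rw [hπ' i hi (cellLen (T + 1) (s i) - 1 - t) (by rw [hs]; omega) u' (by omega), hs, hr,
        cellCol_reverse _ _ _ _ htl]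
  · intro u h1 h2
    rw [mk u (by omega) (by omega)]
    omega
  · intro u h1 h2
    rw [mk u (by omega) (by omega)]
    omega
  · intro u h1 h2
    rw [mk u (by omega) (by omega)]
    omega
  · intro u h1 h2
    rw [mk u (by omega) (by omega)]
    omega

theorem cellCol_left (K : ℕ) (r s s' : Bool) (t : ℕ) (ht : t < 3 * K) :
    cellCol K r s t = cellCol K r s' t := by
  unfold cellCol
  simp [show ¬ 3 * K ≤ t by omega]

theorem cellCol_right (K : ℕ) (r s s' : Bool) (t t' : ℕ) (ht : cellLen K s ≤ t + 3 * K)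
    (h : t' + cellLen K s = t + cellLen K s') :
    cellCol K r s t = cellCol K r s' t' := by
  unfold cellLen at *
  unfold cellCol
  cases r <;> cases s <;> cases s' <;> simp at * <;> (try split_ifs) <;> omega

/-- The segment runs from the right marker block of one cell through the left block of the next.
Between a block and the middle lie `T + 1` columns, so a deleted middle column goes unnoticed. -/
theorem IsArrangement.segmentMatch_joint {N Q T : ℕ} {r s s' : ℕ → Bool}
    {π π' : Equiv.Perm (Fin N)} (hN : Q * (6 * (T + 1) + 1) ≤ N)
    (hπ : IsArrangement N Q (T + 1) r s π) (hπ' : IsArrangement N Q (T + 1) r s' π')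
    (i : ℕ) (hi : i + 1 < Q) :
    SegmentMatch N T (IsMarker (T + 1)) π π' 1 (cellStart (T + 1) s (i + 1) - 2 * (T + 1))
      (cellStart (T + 1) s' (i + 1) - 2 * (T + 1)) (4 * (T + 1) - 1) := by
  have b := cellStart_add_lt hN s (i + 1) hi
  have b' := cellStart_add_lt hN s' (i + 1) hi
  have l := le_cellLen (T + 1) (s i)
  have l' := le_cellLen (T + 1) (s' i)
  have k := le_cellLen (T + 1) (s (i + 1))
  have k' := le_cellLen (T + 1) (s' (i + 1))
  have e := cellStart_succ (T + 1) s i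
  have e' := cellStart_succ (T + 1) s' i
  have mk1 := fun (u : Fin N) (h1 : cellStart (T + 1) s i ≤ u)
    (h2 : (u : ℕ) < cellStart (T + 1) s i + cellLen (T + 1) (s i)) =>
    hπ.isMarker i (by omega) u (u - cellStart (T + 1) s i) (by omega) (by omega)
  have mk2 := fun (u : Fin N) (h1 : cellStart (T + 1) s (i + 1) ≤ u)
    (h2 : (u : ℕ) < cellStart (T + 1) s (i + 1) + cellLen (T + 1) (s (i + 1))) =>
    hπ.isMarker (i + 1) hi u (u - cellStart (T + 1) s (i + 1)) (by omega) (by omega)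
  refine ⟨Or.inl rfl, ?_, ?_, ?_, ?_, ?_, ?_, ?_, ?_, ?_, ?_, ?_⟩
  · omega
  · omega
  · omega
  · omega
  · omega
  · omega
  · intro u u' hu1 hu2 huu
    rw [Fin.ext_iff]
    by_cases hc : (u : ℕ) < cellStart (T + 1) s (i + 1)
    · obtain ⟨t, ht⟩ : ∃ t, (u : ℕ) = cellStart (T + 1) s i + t :=
        ⟨u - cellStart (T + 1) s i, by omega⟩
      obtain ⟨t', ht'⟩ : ∃ t', (u' : ℕ) = cellStart (T + 1) s' i + t' :=
        ⟨u' - cellStart (T + 1) s' i, by omega⟩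
      rw [hπ i (by omega) t (by omega) u ht, hπ' i (by omega) t' (by omega) u' ht',
        cellCol_right (T + 1) (r i) (s i) (s' i) t t' (by omega) (by omega)]
    · obtain ⟨t, ht⟩ : ∃ t, (u : ℕ) = cellStart (T + 1) s (i + 1) + t :=
        ⟨u - cellStart (T + 1) s (i + 1), by omega⟩
      rw [hπ (i + 1) hi t (by omega) u ht, hπ' (i + 1) hi t (by omega) u' (by omega),
        cellCol_left (T + 1) (r (i + 1)) (s (i + 1)) (s' (i + 1)) t (by omega)]
  · intro u h1 h2
    rw [mk1 u (by omega) (by omega)]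
    omega
  · intro u h1 h2
    rw [mk2 u (by omega) (by omega)]
    omega
  · intro u h1 h2
    rw [mk1 u (by omega) (by omega)]
    omega
  · intro u h1 h2
    rw [mk2 u (by omega) (by omega)]
    omega

/-! ### Adding up heights to a contradiction -/

/-- The height difference along the `i`-th cell, margins excluded. -/
def cellHeight (K : ℕ) (s : ℕ → Bool) (h : ℕ → ℤ) (i : ℕ) : ℤ :=
  h (cellStart K s i + (cellLen K (s i) - 1 - K)) - h (cellStart K s i + K)

section

variable {N T y₀ y₁ Q : ℕ} {f : Equiv.Perm (Fin N) → ℕ → ℕ → Fin 3}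
  {h : Equiv.Perm (Fin N) → ℕ → ℕ → ℤ}

theorem IsLocalFamily.cellHeight_eq (hf : IsLocalFamily N T y₀ y₁ (IsMarker (T + 1)) f)
    (hh : ∀ π, IsHeight N (f π) (h π)) (hy : y₀ < N) (hN : Q * (6 * (T + 1) + 1) ≤ N)
    {r s r' s' : ℕ → Bool} {π π' : Equiv.Perm (Fin N)}
    (hπ : IsArrangement N Q (T + 1) r s π) (hπ' : IsArrangement N Q (T + 1) r' s' π')
    (i : ℕ) (hi : i < Q) (hs : s' i = s i) :
    cellHeight (T + 1) s (h π · y₀) i =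
      (if r' i = r i then 1 else -1) * cellHeight (T + 1) s' (h π' · y₀) i := by
  have b := cellStart_add_lt hN s i hi
  have b' := cellStart_add_lt hN s' i hi
  have l := le_cellLen (T + 1) (s i)
  unfold cellHeight
  rw [hs] at b' ⊢
  split_ifs with hr
  · have hm := hπ.segmentMatch_cell hN hπ' i hi hs 1 _ (Or.inl ⟨rfl, hr, rfl⟩)
    rw [one_mul]
    refine (hh π).sub_eq_sub (hh π') y₀ hy 1 (Or.inl rfl) _ _
      (cellLen (T + 1) (s i) - 1 - 2 * (T + 1)) _ _ (by omega) (by push_cast; omega) (by omega)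
      (by omega) (by omega) ?_
    intro u u' h1 h2 h3
    exact hf.segment π π' _ _ _ _ hm u u' (by omega) (by omega) (by push_cast at h3; omega)
  · have hr' : r' i = !r i := by
      revert hr; cases r' i <;> cases r i <;> simp
    have hm := hπ.segmentMatch_cell hN hπ' i hi hs (-1) _ (Or.inr ⟨rfl, hr', rfl⟩)
    rw [neg_one_mul, neg_sub]
    refine (hh π).sub_eq_sub (hh π') y₀ hy (-1) (Or.inr rfl) _ _
      (cellLen (T + 1) (s i) - 1 - 2 * (T + 1)) _ _ (by omega) (by push_cast; omega) (by omega)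
      (by omega) (by omega) ?_
    intro u u' h1 h2 h3
    exact hf.segment π π' _ _ _ _ hm u u' (by omega) (by omega) (by push_cast at h3; omega)

theorem IsLocalFamily.joint_eq (hf : IsLocalFamily N T y₀ y₁ (IsMarker (T + 1)) f)
    (hh : ∀ π, IsHeight N (f π) (h π)) (hy : y₀ < N) (hN : Q * (6 * (T + 1) + 1) ≤ N)
    {r s s' : ℕ → Bool} {π π' : Equiv.Perm (Fin N)}
    (hπ : IsArrangement N Q (T + 1) r s π) (hπ' : IsArrangement N Q (T + 1) r s' π')
    (i : ℕ) (hi : i + 1 < Q) :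
    h π (cellStart (T + 1) s (i + 1) + (T + 1)) y₀ -
        h π (cellStart (T + 1) s i + (cellLen (T + 1) (s i) - 1 - (T + 1))) y₀ =
      h π' (cellStart (T + 1) s' (i + 1) + (T + 1)) y₀ -
        h π' (cellStart (T + 1) s' i + (cellLen (T + 1) (s' i) - 1 - (T + 1))) y₀ := by
  have b := cellStart_add_lt hN s (i + 1) hi
  have b' := cellStart_add_lt hN s' (i + 1) hi
  have l := le_cellLen (T + 1) (s i)
  have l' := le_cellLen (T + 1) (s' i)
  have k := le_cellLen (T + 1) (s (i + 1))
  have k' := le_cellLen (T + 1) (s' (i + 1))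
  have e := cellStart_succ (T + 1) s i
  have e' := cellStart_succ (T + 1) s' i
  have hm := hπ.segmentMatch_joint hN hπ' i hi
  refine (hh π).sub_eq_sub (hh π') y₀ hy 1 (Or.inl rfl) _ _ (2 * (T + 1) + 1) _ _ (by omega)
    (by push_cast; omega) (by omega) (by omega) (by omega) ?_
  intro u u' h1 h2 h3
  exact hf.segment π π' _ _ _ _ hm u u' (by omega) (by omega) (by omega)

theorem IsLocalFamily.contradiction (hf : IsLocalFamily N T y₀ y₁ (IsMarker (T + 1)) f)
    (hh : ∀ π, IsHeight N (f π) (h π)) (hy : y₀ < N) (hy₁ : y₀ = y₁ + (2 * T + 1))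
    (hN : (8 * T + 7) * (6 * T + 7) ≤ N) : False := by
  have hN' : (8 * T + 7) * (6 * (T + 1) + 1) ≤ N := by
    rwa [show 6 * (T + 1) + 1 = 6 * T + 7 by ring]
  obtain ⟨πL, hL⟩ := exists_isArrangement N _ _ hN' (fun _ => false) (fun _ => false)
  obtain ⟨πS, hS⟩ := exists_isArrangement N _ _ hN' (fun _ => false) (fun _ => true)
  set L := cellHeight (T + 1) (fun _ => false) (h πL · y₀) with hLdef
  set S := cellHeight (T + 1) (fun _ => true) (h πS · y₀) with hSdef
  -- The measured lengths are `4 * (T + 1)` and `4 * (T + 1) - 1`, of opposite parity.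
  have hne : ∀ i < 8 * T + 7, L i ≠ S i := by
    intro i hi hLS
    have b1 := cellStart_add_lt hN' (fun _ => false) i hi
    have b2 := cellStart_add_lt hN' (fun _ => true) i hi
    have h1 := (hh πL).even_sub y₀ hy (cellStart (T + 1) (fun _ => false) i + (T + 1))
      (4 * (T + 1)) (by simp only [cellLen] at b1; simp at b1; omega)
    have h2 := (hh πS).even_sub y₀ hy (cellStart (T + 1) (fun _ => true) i + (T + 1))
      (4 * (T + 1) - 1) (by simp only [cellLen] at b2; simp at b2; omega)
    have e1 : L i = _ - _ := rfl
    have e2 : S i = _ - _ := rfl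
    have g1 : cellLen (T + 1) false - 1 - (T + 1) = (T + 1) + 4 * (T + 1) := by
      simp [cellLen]; omega
    have g2 : cellLen (T + 1) true - 1 - (T + 1) = (T + 1) + (4 * (T + 1) - 1) := by
      simp [cellLen]; omega
    simp only [g1, ← add_assoc] at e1
    simp only [g2, ← add_assoc] at e2
    simp only [← add_assoc] at h1 h2
    rw [← e1] at h1
    rw [← e2, ← hLS] at h2
    rw [Int.even_iff] at h1 h2
    omega
  set m := 4 * T + 3 with hm
  -- A cell is reversed exactly when its version in `πA` has the smaller height difference. Sharing
  -- `r` keeps the joints equal.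
  let r : ℕ → Bool := fun i => if i < m then decide (L i < S i) else decide (S i < L i)
  let sA : ℕ → Bool := fun i => decide (m ≤ i)
  let sB : ℕ → Bool := fun i => decide (i < m)
  obtain ⟨πA, hA⟩ := exists_isArrangement N _ _ hN' r sA
  obtain ⟨πB, hB⟩ := exists_isArrangement N _ _ hN' r sB
  have hcell : ∀ i < 8 * T + 7, cellHeight (T + 1) sB (h πB · y₀) i + 1 ≤
      cellHeight (T + 1) sA (h πA · y₀) i := by
    intro i hi
    have h3 := hne i hi
    by_cases him : i < m
    · have h1 := hf.cellHeight_eq hh hy hN' hA hL i hi (by simp [sA, him])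
      have h2 := hf.cellHeight_eq hh hy hN' hB hS i hi (by simp [sB, him])
      rw [h1, h2, ← hLdef, ← hSdef]
      have hr : r i = decide (L i < S i) := if_pos him
      rw [hr]
      by_cases hlt : L i < S i
      · simp [hlt]
      · simp [hlt]; omega
    · have h1 := hf.cellHeight_eq hh hy hN' hA hS i hi (by simp [sA]; omega)
      have h2 := hf.cellHeight_eq hh hy hN' hB hL i hi (by simp [sB]; omega)
      rw [h1, h2, ← hLdef, ← hSdef]
      have hr : r i = decide (S i < L i) := if_neg him
      rw [hr]
      by_cases hlt : S i < L i
      · simp [hlt]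
      · simp [hlt]; omega
  have hsum : ∀ i < 8 * T + 7,
      h πB (cellStart (T + 1) sB i + (T + 1)) y₀ - h πB (T + 1) y₀ + i ≤
      h πA (cellStart (T + 1) sA i + (T + 1)) y₀ - h πA (T + 1) y₀ := by
    intro i hi
    induction i with
    | zero => simp [cellStart]
    | succ i ih =>
      have h1 := ih (by omega)
      have h2 := hcell i (by omega)
      have h3 := hf.joint_eq hh hy hN' hA hB i hi
      unfold cellHeight at h2
      push_cast
      linarith
  have startA : ∀ i, cellStart (T + 1) sA i + (i - m) = i * (6 * (T + 1) + 1) := by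
    intro i
    induction i with
    | zero => simp [cellStart]
    | succ i ih =>
      rw [cellStart_succ, Nat.succ_mul, ← ih]
      by_cases him : m ≤ i
      · simp [sA, him, cellLen]; omega
      · simp [sA, him, cellLen]; omega
  have startB : ∀ i, cellStart (T + 1) sB i + min i m = i * (6 * (T + 1) + 1) := by
    intro i
    induction i with
    | zero => simp [cellStart]
    | succ i ih =>
      rw [cellStart_succ, Nat.succ_mul, ← ih]
      by_cases him : i < m
      · simp [sB, him, cellLen]; omega
      · simp [sB, him, cellLen]; omega
  have hfin := hsum (2 * m) (by omega)
  -- Both arrangements have `m` short cells among the first `2 * m`; cell `2 * m` only provides the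
  -- right endpoint.
  have hAB : cellStart (T + 1) sB (2 * m) = cellStart (T + 1) sA (2 * m) := by
    have h1 := startA (2 * m)
    have h2 := startB (2 * m)
    omega
  rw [hAB] at hfin
  have b := cellStart_add_lt hN' sA (2 * m) (by omega)
  have l := le_cellLen (T + 1) (sA (2 * m))
  set x := cellStart (T + 1) sA (2 * m) with hx
  have hA' := (hh πA).abs_sub_le (x + (T + 1)) (T + 1) (by omega) (by omega) y₁ (2 * T + 1)
    (by omega)
  have hB' := (hh πB).abs_sub_le (x + (T + 1)) (T + 1) (by omega) (by omega) y₁ (2 * T + 1)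
    (by omega)
  have hC := (hh πA).sub_eq_sub (hh πB) y₁ (by omega) 1 (Or.inl rfl) (T + 1) (T + 1) x
    (x + (T + 1)) (x + (T + 1)) (by omega) (by push_cast; ring) (by omega) (by omega) (by omega)
    (by
      intro u u' h1 h2 h3
      have : u' = u := by omega
      rw [this]
      exact hf.fixed πA πB u (by omega))
  rw [← hy₁, abs_le] at hA' hB'
  push_cast at *
  omega

end

/-! ### From a single grid to the asymptotic statement -/

/-- No algorithm of locality `T` finds a 3-coloring in the square grid with side length at least
`(8 * T + 7) * (6 * T + 7)`. -/
theorem not_findsColoring_of_le {M : Type*} (c : ℕ) (hc : 1 ≤ c) (A : SLOCALAlgorithm M (Fin 3))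
    (N : ℕ) (hN : (8 * A.locality (N * N) + 7) * (6 * A.locality (N * N) + 7) ≤ N) :
    ¬ A.FindsColoring c (fun G => IsGridGraph G) := by
  intro hA
  set T := A.locality (N * N) with hT
  have hy : 3 * T + 1 < N := by nlinarith
  obtain ⟨f, h, hf, hh⟩ := exists_isLocalFamily c hc A hA N T (2 * T + 1) (3 * T + 1) T hT
    (by omega) (by omega) hy (IsMarker (T + 1))
  exact hf.contradiction hh hy (by omega) hN

theorem exists_side_of_isLittleO (T : ℕ → ℕ)
    (hT : (fun n : ℕ => (T n : ℝ)) =o[atTop] (fun n : ℕ => (n : ℝ) ^ (1 / 10 : ℝ))) :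
    ∃ N, (8 * T (N * N) + 7) * (6 * T (N * N) + 7) ≤ N := by
  have h1 := hT.bound (c := 1) one_pos
  have h2 : Tendsto (fun N : ℕ => N * N) atTop atTop := tendsto_id.atTop_mul_atTop₀ tendsto_id
  -- With `n = N * N` the bound reads `t ^ 5 ≤ N`, ample for a quadratic in `t` once `t ≥ 10`; 10000
  -- covers smaller `t`.
  obtain ⟨N, hN, hN'⟩ := ((h2.eventually h1).and (eventually_ge_atTop 10000)).exists
  refine ⟨N, ?_⟩
  set t := T (N * N)
  have h3 : (t : ℝ) ^ 5 ≤ N := by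
    have h0 : (0 : ℝ) ≤ N := Nat.cast_nonneg N
    rw [one_mul, Real.norm_of_nonneg (Nat.cast_nonneg _), Real.norm_of_nonneg (by positivity)] at hN
    calc (t : ℝ) ^ 5 ≤ (((N * N : ℕ) : ℝ) ^ (1 / 10 : ℝ)) ^ 5 :=
          pow_le_pow_left₀ (Nat.cast_nonneg _) hN 5
      _ = N := by
          rw [← Real.rpow_natCast, ← Real.rpow_mul (by positivity), Nat.cast_mul, ← pow_two,
            ← Real.rpow_natCast, ← Real.rpow_mul h0]
          norm_num
  have h4 : t ^ 5 ≤ N := by exact_mod_cast h3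
  by_cases ht : t < 10
  · calc _ ≤ (8 * 9 + 7) * (6 * 9 + 7) := by gcongr <;> omega
      _ ≤ N := by omega
  · have h5 : (8 * t + 7) * (6 * t + 7) ≤ (9 * t) * (7 * t) := by gcongr <;> omega
    have h6 : 10 ^ 3 * t ^ 2 ≤ t ^ 3 * t ^ 2 := by gcongr; omega
    nlinarith

theorem isBipartite_of_isGridGraph {V : Type*} {G : SimpleGraph V} (hG : IsGridGraph G) :
    G.IsBipartite := by
  obtain ⟨a, b, -, -, ⟨e⟩⟩ := hG
  refine ⟨SimpleGraph.Coloring.mk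
    (fun v => (⟨((e v).1 + (e v).2) % 2, Nat.mod_lt _ two_pos⟩ : Fin 2)) ?_⟩
  intro v w hvw
  have h := e.map_adj_iff.2 hvw
  rw [SimpleGraph.boxProd_adj, SimpleGraph.pathGraph_adj, SimpleGraph.pathGraph_adj, Fin.ext_iff,
    Fin.ext_iff] at h
  rw [Ne, Fin.ext_iff]
  simp only
  omega

end SLOCALAlgorithm

open SLOCALAlgorithm in
theorem mainTheorem5 {M : Type*} (c : ℕ) (hc : 1 ≤ c) (A : SLOCALAlgorithm M (Fin 3))
    (hT : (fun n : ℕ => (A.locality n : ℝ)) =o[atTop] (fun n : ℕ => (n : ℝ) ^ (1 / 10 : ℝ))) :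
    ¬ A.FindsColoring c (fun G => IsGridGraph G) ∧
      ¬ A.FindsColoring c (fun G => G.IsBipartite) := by
  obtain ⟨N, hN⟩ := exists_side_of_isLittleO A.locality hT
  have h := not_findsColoring_of_le c hc A N hN
  exact ⟨h, fun h' => h fun V _ G hG => h' V G (isBipartite_of_isGridGraph hG)⟩
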